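/- Consider a $K$-armed bandit ($K\ge 1$) played for $T$ rounds $t=1,\dots,T$. The rewards $X_t(i)$ take values in $[0,B]$, $B>0$, and the reward vectors $(X_t(i))_{i\le K}$ of different rounds are independent. Write $\mu_t(i)=\mathbb E[X_t(i)]$ and $\mu_t^\star=\max_i\mu_t(i)$. Let $\Gamma_T\ge 1$ be an integer such that there are at most $\Gamma_T$ rounds $t\in\{2,\dots,T\}$ in which the distribution of $X_t(i)$ differs from that of $X_{t-1}(i)$ for some arm $i$. In round $t$ the player chooses an arm $I_t$ from the arms played and the rewards received before, and receives $X_t(I_t)$; the regret is $R_T=\sum_{t=1}^T(\mu_t^\star-\mu_t(I_t))$. The sliding-window UCB policy of Garivier and Moulines with window length $\tau\in\{1,2,\dots\}$ and parameter $\xi>1/2$ plays each arm once in the rounds $1,\dots,K$; for $t\ge K$ it plays in round $t+1$ an arm that maximizes $\bar X_t(\tau,i)+c_t(\tau,i)$ (ties broken by any measurable rule based on the observed history), where, with sums over $s\ge 1$ only, $$N_t(\tau,i)=\sum_{s=t-\tau+1}^{t}\mathbf 1(I_s=i),\quad \bar X_t(\tau,i)=\frac{1}{N_t(\tau,i)}\sum_{s=t-\tau+1}^{t}X_s(i)\mathbf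 1(I_s=i),\quad c_t(\tau,i)=B\sqrt{\frac{\xi\log(\min(t,\tau))}{N_t(\tau,i)}},$$ and the index is $+\infty$ if $N_t(\tau,i)=0$. Theorem. Fix $\xi>1/2$. (i) There are $C_j=C_j(\log\tau)$, $j=1,2,3$, depending only on $\xi$ and $\log\tau$ and growing at most polynomially in $\log\tau$, such that for all such $K,T,\tau,\Gamma_T,B$, all reward distributions as above and every such policy (in particular, uniformly in the gaps between the means) $$\mathbb E[R_T]\le B\Big(C_1\sqrt K\,\frac{T}{\sqrt\tau}+C_2\sqrt K\,\tau\,\Gamma_T+C_3K\,\frac{T}{\tau}\Big).$$ (ii) There are $C$ and $p$ depending only on $\xi$ such that, if $T\ge 1$ and $\tau\ge 1$ is the number $T^{2/3}/(K^{1/3}\Gamma_T^{2/3})$ rounded up or down to an integer, then in the same generality $$\mathbb E[R_T]\le B\,C\,(1+\log T)^p\,K^{2/3}\,\Gamma_T^{1/3}\,T^{2/3},$$ that is, $\mathbb E[R_T]=\widetilde{\mathcal O}(K^{2/3}\Gamma_T^{1/3}T^{2/3})$. -/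

import Mathlib

open MeasureTheory ProbabilityTheory

universe u

namespace SWBandit

/-- What the player has observed after `t` rounds (rounds are numbered `0, 1, 2, …`): the arm played
and the reward received in each of the rounds `0, …, t - 1`. -/
abbrev History (K t : ℕ) : Type := Fin t → Fin K × ℝ

/-- A bandit policy: a measurable choice of the arm of round `t` from the arms played and the rewards
received before. -/
structure Policy (K : ℕ) where
  choose : ∀ t : ℕ, History K t → Fin K
  measurable_choose : ∀ t : ℕ, Measurable (choose t)

section Play

variable {K : ℕ}

/-- The history produced by a policy when `x t i` is the reward that arm `i` would give in
round `t`. Only the reward of the played arm is revealed. -/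
def Policy.history (π : Policy K) (x : ℕ → Fin K → ℝ) : ∀ t : ℕ, History K t
  | 0 => Fin.elim0
  | t + 1 =>
      Fin.snoc (π.history x t)
        (π.choose t (π.history x t), x t (π.choose t (π.history x t)))

/-- The arm `I_t` played in round `t`. -/
def Policy.arm (π : Policy K) (x : ℕ → Fin K → ℝ) (t : ℕ) : Fin K :=
  π.choose t (π.history x t)

/-- The rounds, among the last `τ` of the `t` observed ones, in which arm `i` was played. -/
def windowRounds (τ : ℕ) {t : ℕ} (h : History K t) (i : Fin K) : Finset (Fin t) :=
  {s : Fin t | t ≤ (s : ℕ) + τ ∧ (h s).1 = i}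

/-- `N_t(τ, i)`. -/
def windowCount (τ : ℕ) {t : ℕ} (h : History K t) (i : Fin K) : ℕ :=
  (windowRounds τ h i).card

/-- The empirical mean of the rewards of arm `i` in the window
(only used when `windowCount τ h i ≠ 0`). -/
noncomputable def windowMean (τ : ℕ) {t : ℕ} (h : History K t) (i : Fin K) : ℝ :=
  (∑ s ∈ windowRounds τ h i, (h s).2) / (windowCount τ h i : ℝ)

/-- The exploration bonus `c_t(τ, i) = B √(ξ log (min t τ) / N_t(τ, i))`
(only used when `windowCount τ h i ≠ 0`). -/
noncomputable def windowBonus (B ξ : ℝ) (τ : ℕ) {t : ℕ} (h : History K t) (i : Fin K) : ℝ :=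
  B * √(ξ * Real.log ((min t τ : ℕ) : ℝ) / (windowCount τ h i : ℝ))

/-- The upper confidence bound of arm `i`; it is `+∞` for an arm that has not been played within
the window. -/
noncomputable def ucb (B ξ : ℝ) (τ : ℕ) {t : ℕ} (h : History K t) (i : Fin K) : EReal :=
  if windowCount τ h i = 0 then ⊤ else ((windowMean τ h i + windowBonus B ξ τ h i : ℝ) : EReal)

/-- `π` is a sliding-window UCB policy with reward range `B`, exploration parameter `ξ` and window
length `τ`: each arm is played once in the first `K` rounds, then an arm with maximal upper
confidence bound is played (ties are broken by any measurable rule). -/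
def Policy.IsSWUCB (π : Policy K) (B ξ : ℝ) (τ : ℕ) : Prop :=
  ∀ (t : ℕ) (h : History K t),
    (t < K → (π.choose t h : ℕ) = t) ∧
    (K ≤ t → ∀ j : Fin K, ucb B ξ τ h j ≤ ucb B ξ τ h (π.choose t h))

end Play

section Environment

variable {K : ℕ} {Ω : Type u} [MeasurableSpace Ω]

/-- The rewards of a nonstationary `K`-armed bandit: `X t i` is the reward of arm `i` in round `t`.
Rewards lie in `[0, B]`, and the reward vectors of different rounds are independent; no assumption
is made on the joint law of the rewards of different arms in one round. -/
structure IsRewardProcess (P : Measure Ω) (B : ℝ) (X : ℕ → Fin K → Ω → ℝ) : Prop where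
  measurable : ∀ t i, Measurable (X t i)
  mem_Icc : ∀ t i, ∀ᵐ ω ∂P, X t i ω ∈ Set.Icc 0 B
  indep : iIndepFun (fun (t : ℕ) (ω : Ω) (i : Fin K) => X t i ω) P

/-- The mean reward `μ_t(i)`. -/
noncomputable def meanReward (P : Measure Ω) (X : ℕ → Fin K → Ω → ℝ) (t : ℕ) (i : Fin K) : ℝ :=
  ∫ ω, X t i ω ∂P

open scoped Classical in
/-- The rounds of the horizon `0, …, T - 1` in which the reward distribution of some arm differs
from that of the preceding round. -/
noncomputable def changePoints (P : Measure Ω) (X : ℕ → Fin K → Ω → ℝ) (T : ℕ) : Finset ℕ :=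
  {t ∈ Finset.Ico 1 T | ∃ i, P.map (X (t - 1) i) ≠ P.map (X t i)}

/-- The expected (dynamic) regret `E[∑_{t < T} (max_i μ_t(i) - μ_t(I_t))]`. -/
noncomputable def expectedRegret (P : Measure Ω) (X : ℕ → Fin K → Ω → ℝ) (π : Policy K)
    (T : ℕ) : ℝ :=
  ∫ ω, ∑ t ∈ Finset.range T,
    ((⨆ i, meanReward P X t i) - meanReward P X t (π.arm (fun s j => X s j ω) t)) ∂P

end Environment

/-- `C` is bounded on `[0, ∞)` by a polynomial. -/
def PolyGrowth (C : ℝ → ℝ) : Prop :=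
  ∃ (c : ℝ) (p : ℕ), ∀ x : ℝ, 0 ≤ x → |C x| ≤ c * (1 + x) ^ p

end SWBandit

namespace SWBandit

/-! ### Play counts along a path -/

section Histories

variable {K : ℕ}

/-! Discard the first `K` rounds, the first `τ` rounds and the `τ` rounds starting at each change:
these cost at most `B (K + τ + Γ τ)`. In any other round the window is full and all means are
constant on it.

If every arm's window mean is then within its bonus of the true mean, maximality of the index bounds
the regret by twice the bonus of the played arm. No gap enters. To sum these bonuses, cut time into
blocks of length `τ`. The window contains the part of the current block already played, so the
window count may be replaced by the count `n` within the block. In one block the terms `1 / √n` sum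
over each arm to at most twice the root of its count, and Cauchy–Schwarz over the arms gives order
`√(K τ)`. With about `T / τ` blocks this is the term `√K T / √τ` (`sum_blockCost_horizon_le`).

The confidence bounds fail rarely, although the number of plays is random. For each exponent `l`,
the weight `exp (l S - l² B² N / 8)`, with `S` the centred reward sum and `N` the count of an arm,
has mean at most one (`integral_expWeight_le`). Logarithmically many exponents, on a geometric grid,
suffice for one weight to reach `τ` at any failure (`exists_peelRate`); this is where `ξ > 1/2` is
needed. Hence the sum of the weights divided by `τ` dominates the failure indicator, and its mean is
of order `log τ / τ` per arm and round, up to an additive `1 / τ`.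

Part (ii) inserts the tuned `τ`. Where the rounding or the third term would do harm, the claimed
bound already exceeds the trivial bound `B T`. -/

theorem Policy.history_apply (π : Policy K) (x : ℕ → Fin K → ℝ) (t : ℕ) (s : Fin t) :
    π.history x t s = (π.arm x s, x s (π.arm x s)) := by
  induction t with
  | zero => exact s.elim0
  | succ t ih =>
    refine Fin.lastCases ?_ (fun s => ?_) s
    · simp [Policy.history, Policy.arm]
    · simp [Policy.history, ih]

theorem Policy.history_congr (π : Policy K) {x y : ℕ → Fin K → ℝ} {t : ℕ}
    (hxy : ∀ s < t, x s = y s) : π.history x t = π.history y t := by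
  induction t with
  | zero => rfl
  | succ t ih =>
    have h := ih fun s hs => hxy s (hs.trans t.lt_succ_self)
    simp [Policy.history, h, hxy t t.lt_succ_self]

theorem Policy.arm_congr (π : Policy K) {x y : ℕ → Fin K → ℝ} {t : ℕ}
    (hxy : ∀ s < t, x s = y s) : π.arm x t = π.arm y t := by
  rw [Policy.arm, Policy.arm, π.history_congr hxy]

theorem Policy.measurable_history (π : Policy K) (t : ℕ) :
    Measurable fun x : ℕ → Fin K → ℝ => π.history x t := by
  induction t with
  | zero => exact measurable_const
  | succ t ih =>
    have ha : Measurable fun x : ℕ → Fin K → ℝ => π.choose t (π.history x t) :=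
      (π.measurable_choose t).comp ih
    refine measurable_pi_lambda _ fun s => ?_
    refine Fin.lastCases ?_ (fun s => ?_) s
    · simp only [Policy.history, Fin.snoc_last]
      refine ha.prodMk ?_
      have h : Measurable fun p : (Fin K → ℝ) × Fin K => p.1 p.2 :=
        measurable_from_prod_countable_left fun i => measurable_pi_apply i
      exact h.comp ((measurable_pi_apply t).prodMk ha)
    · simp only [Policy.history, Fin.snoc_castSucc]
      exact (measurable_pi_apply s).comp ih

theorem Policy.measurable_arm (π : Policy K) (t : ℕ) :
    Measurable fun x : ℕ → Fin K → ℝ => π.arm x t :=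
  (π.measurable_choose t).comp (π.measurable_history t)

/-- The rounds in `[u, t)` in which the sequence `a` of arms takes the value `i`. -/
def playRounds (a : ℕ → Fin K) (u t : ℕ) (i : Fin K) : Finset ℕ :=
  {s ∈ Finset.Ico u t | a s = i}

theorem windowRounds_history_map (π : Policy K) (x : ℕ → Fin K → ℝ) (τ t : ℕ) (i : Fin K) :
    (windowRounds τ (π.history x t) i).map Fin.valEmbedding =
      playRounds (π.arm x) (t - τ) t i := by
  ext s
  simp only [windowRounds, playRounds, Finset.mem_map, Finset.mem_filter, Finset.mem_univ,
    true_and, Fin.valEmbedding_apply, π.history_apply, Finset.mem_Ico]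
  constructor
  · rintro ⟨s, ⟨h1, h2⟩, rfl⟩
    exact ⟨⟨by omega, s.2⟩, h2⟩
  · rintro ⟨⟨h1, h2⟩, h3⟩
    exact ⟨⟨s, h2⟩, ⟨by simp only; omega, h3⟩, rfl⟩

theorem windowCount_history (π : Policy K) (x : ℕ → Fin K → ℝ) (τ t : ℕ) (i : Fin K) :
    windowCount τ (π.history x t) i = (playRounds (π.arm x) (t - τ) t i).card := by
  rw [windowCount, ← windowRounds_history_map, Finset.card_map]

theorem windowMean_history (π : Policy K) (x : ℕ → Fin K → ℝ) (τ t : ℕ) (i : Fin K) :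
    windowMean τ (π.history x t) i =
      (∑ s ∈ playRounds (π.arm x) (t - τ) t i, x s i) /
        ((playRounds (π.arm x) (t - τ) t i).card : ℝ) := by
  rw [windowMean, windowCount_history, ← windowRounds_history_map, Finset.sum_map]
  congr 1
  refine Finset.sum_congr rfl fun s hs => ?_
  have h := (Finset.mem_filter.1 hs).2.2
  rw [π.history_apply] at h ⊢
  simp only at h
  simp [h]

theorem playRounds_card_le (a : ℕ → Fin K) (u t : ℕ) (i : Fin K) :
    (playRounds a u t i).card ≤ t - u :=
  (Finset.card_filter_le _ _).trans (by simp)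

theorem playRounds_mono (a : ℕ → Fin K) {u v : ℕ} (huv : u ≤ v) (t : ℕ) (i : Fin K) :
    playRounds a v t i ⊆ playRounds a u t i :=
  Finset.filter_subset_filter _ (Finset.Ico_subset_Ico_left huv)

theorem playRounds_succ (a : ℕ → Fin K) {u t : ℕ} (hut : u ≤ t) (i : Fin K) :
    playRounds a u (t + 1) i =
      if a t = i then insert t (playRounds a u t i) else playRounds a u t i := by
  rw [playRounds, ← Finset.insert_Ico_right_eq_Ico_add_one hut, Finset.filter_insert]
  rfl

theorem notMem_playRounds (a : ℕ → Fin K) (u t : ℕ) (i : Fin K) : t ∉ playRounds a u t i := by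
  simp [playRounds]

end Histories

/-! ### Summing bonuses over blocks of window length -/

section BlockSums

variable {K : ℕ}

/-- Successive plays of one arm see the counts 0, 1, 2, …, so regrouping the rounds by the arm
played gives an initial segment of `φ` for each arm. -/
theorem sum_apply_playRounds_card (a : ℕ → Fin K) (φ : ℕ → ℝ) (u n : ℕ) :
    ∑ s ∈ Finset.range n, φ (playRounds a u (u + s) (a (u + s))).card =
      ∑ i, ∑ m ∈ Finset.range (playRounds a u (u + n) i).card, φ m := by
  induction n with
  | zero => simp [playRounds]
  | succ n ih =>
    rw [Finset.sum_range_succ, ih]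
    have h : ∀ i, ∑ m ∈ Finset.range (playRounds a u (u + (n + 1)) i).card, φ m =
        ∑ m ∈ Finset.range (playRounds a u (u + n) i).card, φ m +
          if a (u + n) = i then φ (playRounds a u (u + n) i).card else 0 := by
      intro i
      rw [← add_assoc, playRounds_succ a (Nat.le_add_right u n)]
      split_ifs
      · rw [Finset.card_insert_of_notMem (notMem_playRounds _ _ _ _), Finset.sum_range_succ]
      · simp
    simp [h, Finset.sum_add_distrib]

theorem sum_playRounds_card (a : ℕ → Fin K) (u n : ℕ) :
    ∑ i, ((playRounds a u (u + n) i).card : ℝ) = n := by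
  have h := sum_apply_playRounds_card a (fun _ => 1) u n
  simpa using h.symm

/-- The per-round cost of an arm played `n` times before in the current block. -/
noncomputable def blockCost (c : ℝ) (n : ℕ) : ℝ :=
  (if n = 0 then 1 else 0) + c * (1 / √(n : ℝ))

theorem blockCost_nonneg {c : ℝ} (hc : 0 ≤ c) (n : ℕ) : 0 ≤ blockCost c n := by
  unfold blockCost
  split_ifs <;> positivity

theorem sum_inv_sqrt_le (n : ℕ) : ∑ m ∈ Finset.range n, 1 / √(m : ℝ) ≤ 2 * √(n : ℝ) := by
  have h : ∑ m ∈ Finset.range (n + 1), 1 / √(m : ℝ) ≤ 2 * √(n : ℝ) := by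
    induction n with
    -- The only summand is at `m = 0`, where `1 / √0 = 0` by convention.
    | zero => simp
    | succ n ih =>
      rw [Finset.sum_range_succ]
      have h1 : (0 : ℝ) < √((n + 1 : ℕ) : ℝ) := Real.sqrt_pos.2 (by positivity)
      have h2 := Real.sq_sqrt (Nat.cast_nonneg (α := ℝ) (n + 1))
      have h3 := Real.sq_sqrt (Nat.cast_nonneg (α := ℝ) n)
      push_cast at h1 h2 ⊢
      have h4 : 1 / √((n : ℝ) + 1) ≤ 2 * √((n : ℝ) + 1) - 2 * √(n : ℝ) := by
        rw [div_le_iff₀ h1]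
        nlinarith [sq_nonneg (√((n : ℝ) + 1) - √(n : ℝ))]
      linarith
  refine le_trans (Finset.sum_le_sum_of_subset_of_nonneg
    (Finset.range_subset_range.2 n.le_succ) fun _ _ _ => by positivity) h

theorem sum_range_mul_eq (f : ℕ → ℝ) (n τ : ℕ) :
    ∑ t ∈ Finset.range (n * τ), f t =
      ∑ j ∈ Finset.range n, ∑ s ∈ Finset.range τ, f (j * τ + s) := by
  induction n with
  | zero => simp
  | succ n ih => rw [Nat.succ_mul, Finset.sum_range_add, ih, Finset.sum_range_succ]

theorem sum_blockCost_le {c : ℝ} (hc : 0 ≤ c) (n : ℕ) :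
    ∑ m ∈ Finset.range n, blockCost c m ≤ 1 + 2 * c * √(n : ℝ) := by
  simp only [blockCost, Finset.sum_add_distrib, ← Finset.mul_sum]
  have h1 : ∑ m ∈ Finset.range n, (if m = 0 then (1 : ℝ) else 0) ≤ 1 := by
    rw [Finset.sum_ite_eq']
    split_ifs <;> norm_num
  nlinarith [mul_le_mul_of_nonneg_left (sum_inv_sqrt_le n) hc]

theorem sum_sqrt_playRounds_card_le (a : ℕ → Fin K) (u n : ℕ) :
    ∑ i, √((playRounds a u (u + n) i).card : ℝ) ≤ √(K : ℝ) * √(n : ℝ) := by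
  have h := Real.sum_sqrt_mul_sqrt_le (Finset.univ : Finset (Fin K)) (f := fun _ => 1)
    (g := fun i => ((playRounds a u (u + n) i).card : ℝ)) (fun _ => zero_le_one)
    (fun i => Nat.cast_nonneg _)
  simpa [sum_playRounds_card] using h

theorem sum_blockCost_block_le (a : ℕ → Fin K) {c : ℝ} (hc : 0 ≤ c) (u n : ℕ) :
    ∑ s ∈ Finset.range n, blockCost c (playRounds a u (u + s) (a (u + s))).card ≤
      K + 2 * c * (√(K : ℝ) * √(n : ℝ)) := by
  rw [sum_apply_playRounds_card]
  calc _ ≤ ∑ i, (1 + 2 * c * √((playRounds a u (u + n) i).card : ℝ)) :=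
        Finset.sum_le_sum fun i _ => sum_blockCost_le hc _
    _ = K + 2 * c * ∑ i, √((playRounds a u (u + n) i).card : ℝ) := by
        simp [Finset.sum_add_distrib, Finset.mul_sum]
    _ ≤ _ := by gcongr; exact sum_sqrt_playRounds_card_le a u n

/-- The horizon is padded to whole blocks, which is harmless since the costs are nonnegative. `t / τ
* τ` is the start of the block containing `t`. -/
theorem sum_blockCost_horizon_le (a : ℕ → Fin K) {c : ℝ} (hc : 0 ≤ c) {T τ : ℕ} (hτ : 1 ≤ τ) :
    ∑ t ∈ Finset.range T, blockCost c (playRounds a (t / τ * τ) t (a t)).card ≤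
      ((T : ℝ) / τ + 1) * (K + 2 * c * (√(K : ℝ) * √(τ : ℝ))) := by
  have hT : T ≤ τ * (T / τ + 1) := (Nat.lt_mul_div_succ T hτ).le
  calc _ ≤ ∑ t ∈ Finset.range (τ * (T / τ + 1)),
        blockCost c (playRounds a (t / τ * τ) t (a t)).card :=
        Finset.sum_le_sum_of_subset_of_nonneg (Finset.range_subset_range.2 hT)
          fun _ _ _ => blockCost_nonneg hc _
    _ = ∑ j ∈ Finset.range (T / τ + 1), ∑ s ∈ Finset.range τ,
        blockCost c (playRounds a (j * τ) (j * τ + s) (a (j * τ + s))).card := by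
        rw [mul_comm, sum_range_mul_eq]
        refine Finset.sum_congr rfl fun j _ => Finset.sum_congr rfl fun s hs => ?_
        have h : (j * τ + s) / τ = j := by
          rw [mul_comm, Nat.mul_add_div hτ, Nat.div_eq_of_lt (Finset.mem_range.1 hs), add_zero]
        rw [h]
    _ ≤ ∑ j ∈ Finset.range (T / τ + 1), (K + 2 * c * (√(K : ℝ) * √(τ : ℝ))) :=
        Finset.sum_le_sum fun j _ => sum_blockCost_block_le a hc _ _
    _ ≤ _ := by
        rw [Finset.sum_const, Finset.card_range, nsmul_eq_mul]
        push_cast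
        gcongr
        exact Nat.cast_div_le

end BlockSums

/-! ### Exponential supermartingales under adaptive sampling -/

section Supermartingale

variable {K : ℕ}

/-- The exponential weight `exp (l ∑ (x s i - m s i) - c N)`, where the sum ranges over the `N`
rounds of `[u, t)` in which arm `i` is played. -/
noncomputable def expWeight (π : Policy K) (m : ℕ → Fin K → ℝ) (l c : ℝ) (u t : ℕ) (i : Fin K)
    (x : ℕ → Fin K → ℝ) : ℝ :=
  Real.exp (l * ∑ s ∈ playRounds (π.arm x) u t i, (x s i - m s i) -
    c * ((playRounds (π.arm x) u t i).card : ℝ))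

theorem expWeight_pos (π : Policy K) (m : ℕ → Fin K → ℝ) (l c : ℝ) (u t : ℕ) (i : Fin K)
    (x : ℕ → Fin K → ℝ) : 0 < expWeight π m l c u t i x :=
  Real.exp_pos _

theorem expWeight_self (π : Policy K) (m : ℕ → Fin K → ℝ) (l c : ℝ) (u : ℕ) (i : Fin K)
    (x : ℕ → Fin K → ℝ) : expWeight π m l c u u i x = 1 := by
  simp [expWeight, playRounds]

theorem expWeight_succ (π : Policy K) (m : ℕ → Fin K → ℝ) (l c : ℝ) {u t : ℕ} (hut : u ≤ t)
    (i : Fin K) (x : ℕ → Fin K → ℝ) :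
    expWeight π m l c u (t + 1) i x =
      expWeight π m l c u t i x * (if π.arm x t = i then 0 else 1) +
        expWeight π m l c u t i x * (if π.arm x t = i then 1 else 0) *
          (Real.exp (l * (x t i - m t i)) * Real.exp (-c)) := by
  rw [expWeight, playRounds_succ _ hut]
  split_ifs
  · rw [Finset.sum_insert (notMem_playRounds _ _ _ _),
      Finset.card_insert_of_notMem (notMem_playRounds _ _ _ _), expWeight, ← Real.exp_add,
      mul_zero, mul_one, zero_add, ← Real.exp_add]
    push_cast
    ring_nf
  · simp [expWeight]

theorem expWeight_congr (π : Policy K) (m : ℕ → Fin K → ℝ) (l c : ℝ) (u t : ℕ) (i : Fin K)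
    {x y : ℕ → Fin K → ℝ} (hxy : ∀ s < t, x s = y s) :
    expWeight π m l c u t i x = expWeight π m l c u t i y := by
  have h : playRounds (π.arm x) u t i = playRounds (π.arm y) u t i := by
    refine Finset.filter_congr fun s hs => ?_
    rw [π.arm_congr fun r hr => hxy r (hr.trans (Finset.mem_Ico.1 hs).2)]
  rw [expWeight, expWeight, h]
  congr 3
  refine Finset.sum_congr rfl fun s hs => ?_
  rw [hxy s (Finset.mem_Ico.1 (Finset.mem_filter.1 hs).1).2]

theorem measurableSet_arm_eq (π : Policy K) (t : ℕ) (i : Fin K) :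
    MeasurableSet {x : ℕ → Fin K → ℝ | π.arm x t = i} :=
  π.measurable_arm t (measurableSet_singleton i)

theorem measurable_expWeight (π : Policy K) (m : ℕ → Fin K → ℝ) (l c : ℝ) (u t : ℕ)
    (i : Fin K) : Measurable (expWeight π m l c u t i) := by
  unfold expWeight
  simp only [Finset.card_eq_sum_ones, Nat.cast_sum, playRounds, Finset.sum_filter,
    Nat.cast_ite, Nat.cast_one, Nat.cast_zero]
  refine Real.measurable_exp.comp (Measurable.sub ?_ ?_)
  · refine (Finset.measurable_fun_sum _ fun s _ => ?_).const_mul l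
    refine Measurable.ite (measurableSet_arm_eq π s i) ?_ measurable_const
    exact ((measurable_pi_apply i).comp (measurable_pi_apply s)).sub_const _
  · refine (Finset.measurable_fun_sum _ fun s _ => ?_).const_mul c
    exact Measurable.ite (measurableSet_arm_eq π s i) measurable_const measurable_const

variable {Ω : Type u} [MeasurableSpace Ω] {P : Measure Ω} {B : ℝ} {X : ℕ → Fin K → Ω → ℝ}

theorem IsRewardProcess.measurable_path (hX : IsRewardProcess P B X) :
    Measurable fun ω (s : ℕ) (j : Fin K) => X s j ω :=
  measurable_pi_lambda _ fun s => measurable_pi_lambda _ fun j => hX.measurable s j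

theorem IsRewardProcess.indepFun_past (hX : IsRewardProcess P B X) (t : ℕ)
    {G : (ℕ → Fin K → ℝ) → ℝ} (hG : Measurable G)
    (hGt : ∀ x y : ℕ → Fin K → ℝ, (∀ s < t, x s = y s) → G x = G y)
    {g : (Fin K → ℝ) → ℝ} (hg : Measurable g) :
    IndepFun (fun ω => G fun s j => X s j ω) (fun ω => g fun j => X t j ω) P := by
  have h := hX.indep.indepFun_finset (Finset.range t) {t} (by simp)
    fun s => measurable_pi_lambda _ fun j => hX.measurable s j
  -- `G` factors through the first `t` rounds: extend the finite path by zero, which `G` cannot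
  -- notice.
  have hφ : Measurable fun y : (Finset.range t → Fin K → ℝ) =>
      G fun s => if hs : s ∈ Finset.range t then y ⟨s, hs⟩ else 0 := by
    refine hG.comp (measurable_pi_lambda _ fun s => ?_)
    by_cases hs : s ∈ Finset.range t
    · simpa only [hs, dif_pos] using measurable_pi_apply _
    · simpa only [hs, dif_neg, not_false_eq_true] using measurable_const
  have hψ : Measurable fun y : (({t} : Finset ℕ) → Fin K → ℝ) =>
      g (y ⟨t, Finset.mem_singleton_self t⟩) := hg.comp (measurable_pi_apply _)
  have hc := h.comp hφ hψ
  refine hc.congr (Filter.Eventually.of_forall fun ω => ?_) Filter.EventuallyEq.rfl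
  exact hGt _ _ fun s hs => by simp [hs]

variable [IsProbabilityMeasure P]

theorem IsRewardProcess.exp_bound (hX : IsRewardProcess P B X) (t : ℕ) (i : Fin K) (l : ℝ) :
    Integrable (fun ω => Real.exp (l * (X t i ω - meanReward P X t i))) P ∧
      ∫ ω, Real.exp (l * (X t i ω - meanReward P X t i)) ∂P ≤ Real.exp (l ^ 2 * B ^ 2 / 8) := by
  have h := hasSubgaussianMGF_of_mem_Icc (hX.measurable t i).aemeasurable (hX.mem_Icc t i)
  refine ⟨h.integrable_exp_mul l, (h.mgf_le l).trans_eq ?_⟩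
  congr 1
  simp only [NNReal.coe_pow, NNReal.coe_div, coe_nnnorm, Real.norm_eq_abs, sub_zero, div_pow,
    sq_abs, NNReal.coe_ofNat]
  ring

/-- The weight and the decision to play `i` depend on the past alone, hence are independent of the
new reward. By Hoeffding's lemma the new factor has mean at most one. Centring at each round's own
mean makes this valid across changes. -/
theorem IsRewardProcess.integral_expWeight_le (hX : IsRewardProcess P B X) (π : Policy K)
    (i : Fin K) (l : ℝ) {u t : ℕ} (hut : u ≤ t) :
    Integrable (fun ω => expWeight π (meanReward P X) l (l ^ 2 * B ^ 2 / 8) u t i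
        fun s j => X s j ω) P ∧
      ∫ ω, expWeight π (meanReward P X) l (l ^ 2 * B ^ 2 / 8) u t i (fun s j => X s j ω) ∂P
        ≤ 1 := by
  induction t, hut using Nat.le_induction with
  | base => simp [expWeight_self]
  | succ t hut ih =>
    set c := l ^ 2 * B ^ 2 / 8 with hc
    set m := meanReward P X with hm
    obtain ⟨hi, hle⟩ := ih
    have hmeas (a b : ℝ) : Measurable fun x : ℕ → Fin K → ℝ =>
        if π.arm x t = i then a else b :=
      Measurable.ite (measurableSet_arm_eq π t i) measurable_const measurable_const
    have hint (a b : ℝ) (ha : |a| ≤ 1) (hb : |b| ≤ 1) : Integrable (fun ω =>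
        expWeight π m l c u t i (fun s j => X s j ω) *
          if π.arm (fun s j => X s j ω) t = i then a else b) P := by
      refine hi.mul_bdd (c := 1) ((hmeas a b).comp hX.measurable_path).aestronglyMeasurable
        (Filter.Eventually.of_forall fun ω => ?_)
      split_ifs <;> simpa using ‹_›
    have h0 := hint 0 1 (by simp) (by simp)
    have h1 := hint 1 0 (by simp) (by simp)
    have hindep : IndepFun
        (fun ω => expWeight π m l c u t i (fun s j => X s j ω) *
          if π.arm (fun s j => X s j ω) t = i then 1 else 0)
        (fun ω => Real.exp (l * (X t i ω - m t i)) * Real.exp (-c)) P := by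
      refine hX.indepFun_past t
        (G := fun x => expWeight π m l c u t i x * if π.arm x t = i then 1 else 0)
        (g := fun y => Real.exp (l * (y i - m t i)) * Real.exp (-c))
        ((measurable_expWeight π m l c u t i).mul (hmeas 1 0)) (fun x y hxy => ?_) ?_
      · rw [expWeight_congr π m l c u t i hxy, π.arm_congr hxy]
      · fun_prop
    obtain ⟨hei, hele⟩ := hX.exp_bound t i l
    have he : Integrable (fun ω => Real.exp (l * (X t i ω - m t i)) * Real.exp (-c)) P :=
      hei.mul_const _
    have he1 : ∫ ω, Real.exp (l * (X t i ω - m t i)) * Real.exp (-c) ∂P ≤ 1 := by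
      rw [integral_mul_const, Real.exp_neg, ← div_eq_mul_inv, div_le_one (Real.exp_pos _)]
      exact hele
    have h2 : Integrable (fun ω => expWeight π m l c u t i (fun s j => X s j ω) *
        (if π.arm (fun s j => X s j ω) t = i then 1 else 0) *
          (Real.exp (l * (X t i ω - m t i)) * Real.exp (-c))) P := hindep.integrable_mul h1 he
    simp only [expWeight_succ π m l c hut]
    refine ⟨h0.add h2, ?_⟩
    rw [integral_add h0 h2, hindep.integral_fun_mul_eq_mul_integral h1.1 he.1]
    have h3 : 0 ≤ ∫ ω, expWeight π m l c u t i (fun s j => X s j ω) *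
        (if π.arm (fun s j => X s j ω) t = i then 1 else 0) ∂P := by
      refine integral_nonneg fun ω => mul_nonneg (expWeight_pos _ _ _ _ _ _ _ _).le ?_
      split_ifs <;> simp
    refine (add_le_add_right (mul_le_of_le_one_right h3 he1) _).trans ?_
    rw [← integral_add h0 h1]
    refine le_trans (le_of_eq (integral_congr_ae (Filter.Eventually.of_forall fun ω => ?_))) hle
    simp only
    split_ifs <;> simp

end Supermartingale

/-! ### Peeling over a geometric grid of play counts -/

section Peeling

/-- The ratio of the geometric grid over which the play counts are peeled. -/
noncomputable def peelBase (ξ : ℝ) : ℝ := 1 + √(1 - 1 / (2 * ξ))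

theorem one_lt_peelBase {ξ : ℝ} (hξ : 1 / 2 < ξ) : 1 < peelBase ξ := by
  have h : 1 / (2 * ξ) < 1 := by rw [div_lt_one (by linarith)]; linarith
  have := Real.sqrt_pos.2 (sub_pos.2 h)
  unfold peelBase
  linarith

/-- The ratio is chosen so that the loss from using one exponent on a whole scale consumes exactly
the slack of `2 ξ` over 1. -/
theorem peelBase_identity {ξ : ℝ} (hξ : 1 / 2 < ξ) :
    2 * ξ * (1 - (peelBase ξ - 1) ^ 2) = 1 := by
  have h : 1 / (2 * ξ) < 1 := by rw [div_lt_one (by linarith)]; linarith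
  have h2 : ξ ≠ 0 := by linarith
  rw [peelBase, add_sub_cancel_left, Real.sq_sqrt (sub_pos.2 h).le]
  field_simp
  ring

/-- The exponents used for play counts of order `peelBase ξ ^ (2 * k)`. -/
noncomputable def peelRate (ξ B L : ℝ) (k : ℕ) : ℝ := 4 * √(ξ * L) / (B * peelBase ξ ^ k)

/-- The number of scales needed for play counts up to `exp L`. -/
noncomputable def peelCount (ξ L : ℝ) : ℕ := ⌊L / (2 * Real.log (peelBase ξ))⌋₊ + 1

/-- Take `k` with `q ^ k ≤ √N < q ^ (k + 1)` and put `r = √N / q ^ k`, `L = log τ`. The exponent is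
at least `2 ξ L (1 - (r - 1)²)`. As `r` lies in `[1, q)`, this is at least `2 ξ L (1 - (q - 1)²) =
L`. -/
theorem exists_peelRate {ξ B : ℝ} (hξ : 1 / 2 < ξ) (hB : 0 < B) {N τ : ℕ} (hN : 1 ≤ N)
    (hNτ : N ≤ τ) {S : ℝ} (hS : B * √(ξ * Real.log τ) * √(N : ℝ) ≤ S) :
    ∃ k < peelCount ξ (Real.log τ), (τ : ℝ) ≤ Real.exp (peelRate ξ B (Real.log τ) k * S -
      peelRate ξ B (Real.log τ) k ^ 2 * B ^ 2 / 8 * (N : ℝ)) := by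
  have hN' : (1 : ℝ) ≤ N := by exact_mod_cast hN
  have hNτ' : (N : ℝ) ≤ τ := by exact_mod_cast hNτ
  have hτ : (0 : ℝ) < τ := by linarith
  have hL : 0 ≤ Real.log τ := Real.log_nonneg (hN'.trans hNτ')
  have hq := one_lt_peelBase hξ
  have hid := peelBase_identity hξ
  unfold peelRate peelCount
  set q := peelBase ξ
  set L := Real.log τ with hLdef
  obtain ⟨k, hk1, hk2⟩ := exists_nat_pow_near (Real.one_le_sqrt.2 hN') hq
  have hq0 : 0 < q ^ k := pow_pos (by linarith) k
  have hsq := Real.sq_sqrt (Nat.cast_nonneg (α := ℝ) N)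
  refine ⟨k, Nat.lt_succ_of_le (Nat.le_floor ?_), ?_⟩
  · rw [le_div_iff₀ (by have := Real.log_pos hq; positivity)]
    have h1 : (q ^ k) ^ 2 ≤ τ := by
      refine le_trans ?_ hNτ'
      rw [← hsq]
      gcongr
    have h2 := Real.log_le_log (by positivity) h1
    rw [Real.log_pow, Real.log_pow] at h2
    push_cast at h2
    linarith
  · rw [← Real.log_le_iff_le_exp hτ, ← hLdef]
    set r := √(N : ℝ) / q ^ k with hr
    have hr1 : 1 ≤ r := (one_le_div hq0).2 hk1
    have hr2 : r < q := by rw [hr, div_lt_iff₀ hq0, ← pow_succ']; exact hk2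
    have hy : √(ξ * L) ^ 2 = ξ * L := Real.sq_sqrt (mul_nonneg (by linarith) hL)
    have h1 : 4 * (ξ * L) * r ≤ 4 * √(ξ * L) / (B * q ^ k) * S := by
      refine le_trans (le_of_eq ?_) (mul_le_mul_of_nonneg_left hS (by positivity))
      rw [hr]
      field_simp
      rw [hy]
    have h2 : (4 * √(ξ * L) / (B * q ^ k)) ^ 2 * B ^ 2 / 8 * (N : ℝ) = 2 * (ξ * L) * r ^ 2 := by
      rw [hr, div_pow, div_pow, mul_pow, mul_pow, hy, hsq]
      field_simp
      ring
    rw [h2]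
    have h3 : (r - 1) ^ 2 ≤ (q - 1) ^ 2 := by gcongr
    have h4 : 0 ≤ ξ * L := mul_nonneg (by linarith) hL
    have h5 : L = 2 * (ξ * L) * (1 - (q - 1) ^ 2) := by
      linear_combination (-L) * hid
    nlinarith [mul_le_mul_of_nonneg_left h3 h4]

variable {K : ℕ}

/-- The sum of the exponential weights over all scales and both signs. -/
noncomputable def peelWeight (π : Policy K) (m : ℕ → Fin K → ℝ) (ξ B : ℝ) (τ t : ℕ)
    (i : Fin K) (x : ℕ → Fin K → ℝ) : ℝ :=
  ∑ k ∈ Finset.range (peelCount ξ (Real.log τ)),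
    (expWeight π m (peelRate ξ B (Real.log τ) k)
        (peelRate ξ B (Real.log τ) k ^ 2 * B ^ 2 / 8) (t - τ) t i x +
      expWeight π m (-peelRate ξ B (Real.log τ) k)
        ((-peelRate ξ B (Real.log τ) k) ^ 2 * B ^ 2 / 8) (t - τ) t i x)

theorem peelWeight_nonneg (π : Policy K) (m : ℕ → Fin K → ℝ) (ξ B : ℝ) (τ t : ℕ)
    (i : Fin K) (x : ℕ → Fin K → ℝ) : 0 ≤ peelWeight π m ξ B τ t i x :=
  Finset.sum_nonneg fun _ _ => add_nonneg (expWeight_pos _ _ _ _ _ _ _ _).le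
    (expWeight_pos _ _ _ _ _ _ _ _).le

/-- All weights are positive, so their sum dominates the one selected by the scale of the count and
the sign of the deviation; this replaces a union bound. -/
theorem le_peelWeight_of_deviation (π : Policy K) (m : ℕ → Fin K → ℝ) {ξ B : ℝ}
    (hξ : 1 / 2 < ξ) (hB : 0 < B) (τ t : ℕ) (i : Fin K) (x : ℕ → Fin K → ℝ)
    (hN : 1 ≤ (playRounds (π.arm x) (t - τ) t i).card)
    (hS : B * √(ξ * Real.log τ) * √((playRounds (π.arm x) (t - τ) t i).card : ℝ) ≤
      |∑ s ∈ playRounds (π.arm x) (t - τ) t i, (x s i - m s i)|) :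
    (τ : ℝ) ≤ peelWeight π m ξ B τ t i x := by
  have hNτ : (playRounds (π.arm x) (t - τ) t i).card ≤ τ :=
    (playRounds_card_le _ _ _ _).trans (by omega)
  obtain ⟨k, hk, hle⟩ := exists_peelRate hξ hB hN hNτ hS
  refine hle.trans (le_trans ?_ (Finset.single_le_sum (fun j _ =>
    add_nonneg (expWeight_pos π m _ _ _ _ i x).le (expWeight_pos π m _ _ _ _ i x).le)
    (Finset.mem_range.2 hk)))
  rcases abs_choice (∑ s ∈ playRounds (π.arm x) (t - τ) t i, (x s i - m s i)) with h | h
  · rw [h]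
    exact le_add_of_nonneg_right (expWeight_pos π m _ _ _ _ i x).le
  · rw [h]
    refine le_trans (le_of_eq ?_) (le_add_of_nonneg_left (expWeight_pos π m _ _ _ _ i x).le)
    rw [expWeight, neg_sq]
    congr 2
    ring

end Peeling

/-! ### Regret in a round with a stationary window -/

section Pointwise

variable {K : ℕ}

theorem abs_windowMean_sub_le (π : Policy K) {m : ℕ → Fin K → ℝ} {ξ B : ℝ}
    (hξ : 1 / 2 < ξ) (hB : 0 < B) {τ t : ℕ} (hτt : τ ≤ t) (i : Fin K) (x : ℕ → Fin K → ℝ)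
    (hm : ∀ s, t - τ ≤ s → s < t → m s i = m t i)
    (hN : windowCount τ (π.history x t) i ≠ 0)
    (hw : peelWeight π m ξ B τ t i x < τ) :
    |windowMean τ (π.history x t) i - m t i| ≤ windowBonus B ξ τ (π.history x t) i := by
  rw [windowCount_history] at hN
  have hN1 := Nat.one_le_iff_ne_zero.2 hN
  have h := lt_of_not_ge fun h => hw.not_ge (le_peelWeight_of_deviation π m hξ hB τ t i x hN1 h)
  rw [windowMean_history, windowBonus, windowCount_history, min_eq_right hτt]
  set A := playRounds (π.arm x) (t - τ) t i
  have hN0 : (0 : ℝ) < A.card := by exact_mod_cast hN1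
  have hs : ∑ s ∈ A, (x s i - m s i) = ∑ s ∈ A, x s i - A.card * m t i := by
    rw [Finset.sum_sub_distrib]
    congr 1
    rw [← nsmul_eq_mul, ← Finset.sum_const]
    refine Finset.sum_congr rfl fun s hs => ?_
    have h := Finset.mem_Ico.1 (Finset.mem_filter.1 hs).1
    exact hm s h.1 h.2
  have he : (∑ s ∈ A, x s i) / (A.card : ℝ) - m t i = (∑ s ∈ A, (x s i - m s i)) / A.card := by
    rw [hs]
    field_simp
  rw [he, abs_div, abs_of_pos hN0, div_le_iff₀ hN0, Real.sqrt_div' _ hN0.le]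
  refine h.le.trans (le_of_eq ?_)
  have hsq := Real.sq_sqrt hN0.le
  have hp := Real.sqrt_pos.2 hN0
  field_simp
  rw [hsq]

/-- The weight term pays for failed confidence bounds, the unit in `blockCost` for the first play of
an arm in a block. Otherwise both bounds hold, and the regret is at most twice the bonus of the
played arm. -/
theorem regret_le_of_stationary {π : Policy K} {m : ℕ → Fin K → ℝ} {ξ B : ℝ}
    (hξ : 1 / 2 < ξ) (hB : 0 < B) {τ t : ℕ} (hπ : π.IsSWUCB B ξ τ) (hτ : 1 ≤ τ) (hτt : τ ≤ t)
    (hKt : K ≤ t) (x : ℕ → Fin K → ℝ) (i : Fin K)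
    (hm : ∀ i s, t - τ ≤ s → s < t → m s i = m t i) (hmB : ∀ i, m t i ∈ Set.Icc 0 B) :
    m t i - m t (π.arm x t) ≤
      B * (blockCost (2 * √(ξ * Real.log τ))
          (playRounds (π.arm x) (t / τ * τ) t (π.arm x t)).card +
        (∑ j, peelWeight π m ξ B τ t j x) / τ) := by
  have hc : 0 ≤ 2 * √(ξ * Real.log τ) := by positivity
  have hτ0 : (0 : ℝ) < τ := by exact_mod_cast hτ
  have hsum : 0 ≤ (∑ j, peelWeight π m ξ B τ t j x) / τ :=
    div_nonneg (Finset.sum_nonneg fun j _ => peelWeight_nonneg _ _ _ _ _ _ _ _) hτ0.le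
  have htriv : m t i - m t (π.arm x t) ≤ B := by
    linarith [(hmB i).2, (hmB (π.arm x t)).1]
  by_cases hw : ∃ j, (τ : ℝ) ≤ peelWeight π m ξ B τ t j x
  · obtain ⟨j, hj⟩ := hw
    have h1 : 1 ≤ (∑ j, peelWeight π m ξ B τ t j x) / τ := by
      rw [one_le_div hτ0]
      exact hj.trans (Finset.single_le_sum (f := fun j => peelWeight π m ξ B τ t j x)
        (fun j _ => peelWeight_nonneg _ _ _ _ _ _ _ _) (Finset.mem_univ j))
    refine htriv.trans (le_mul_of_one_le_right hB.le ?_)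
    linarith [blockCost_nonneg hc (playRounds (π.arm x) (t / τ * τ) t (π.arm x t)).card]
  push Not at hw
  set a := π.arm x t with ha
  set n := (playRounds (π.arm x) (t / τ * τ) t a).card with hn
  rcases Nat.eq_zero_or_pos n with h0 | hpos
  · refine htriv.trans (le_mul_of_one_le_right hB.le ?_)
    rw [h0]
    simpa [blockCost] using hsum
  -- The current block starts no earlier than the window does.
  have hnN : n ≤ windowCount τ (π.history x t) a := by
    rw [windowCount_history]
    refine Finset.card_le_card (playRounds_mono _ ?_ _ _)
    have h1 := Nat.div_add_mod' t τ
    have h2 := Nat.mod_lt t hτ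
    omega
  have hNa : windowCount τ (π.history x t) a ≠ 0 := by omega
  have hu : ucb B ξ τ (π.history x t) i ≤ ucb B ξ τ (π.history x t) a :=
    (hπ t (π.history x t)).2 hKt i
  -- An arm absent from the window has index `⊤` and would beat the finite index of `a`.
  have hNi : windowCount τ (π.history x t) i ≠ 0 := by
    intro h
    rw [ucb, if_pos h, ucb, if_neg hNa] at hu
    exact (EReal.coe_lt_top _).not_ge hu
  rw [ucb, if_neg hNi, ucb, if_neg hNa, EReal.coe_le_coe_iff] at hu
  have hi := abs_le.1 (abs_windowMean_sub_le π hξ hB hτt i x (hm i) hNi (hw i))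
  have hb := abs_le.1 (abs_windowMean_sub_le π hξ hB hτt a x (hm a) hNa (hw a))
  have hbonus : windowBonus B ξ τ (π.history x t) a ≤
      B * (√(ξ * Real.log τ) * (1 / √(n : ℝ))) := by
    have hn0 : (0 : ℝ) < n := by exact_mod_cast hpos
    rw [windowBonus, min_eq_right hτt, Real.sqrt_div' _ (Nat.cast_nonneg _), div_eq_mul_one_div]
    have := Real.sqrt_pos.2 hn0
    gcongr
  have hcost : 2 * (B * (√(ξ * Real.log τ) * (1 / √(n : ℝ)))) ≤
      B * blockCost (2 * √(ξ * Real.log τ)) n := by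
    rw [blockCost, if_neg hpos.ne']
    exact le_of_eq (by ring)
  have := mul_nonneg hB.le hsum
  rw [mul_add]
  linarith [hi.1, hb.2]

end Pointwise

/-! ### Stationarity between change points -/

section Means

variable {K : ℕ} {Ω : Type u} [MeasurableSpace Ω] {P : Measure Ω}
  {B : ℝ} {X : ℕ → Fin K → Ω → ℝ}

theorem IsRewardProcess.meanReward_eq_of_map_eq (hX : IsRewardProcess P B X) {s t : ℕ}
    {i : Fin K} (h : P.map (X s i) = P.map (X t i)) :
    meanReward P X s i = meanReward P X t i := by
  have h' (r : ℕ) : meanReward P X r i = ∫ y, y ∂(P.map (X r i)) :=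
    (integral_map (hX.measurable r i).aemeasurable aestronglyMeasurable_id).symm
  rw [h', h', h]

theorem IsRewardProcess.meanReward_eq_of_no_change (hX : IsRewardProcess P B X) {s t T : ℕ}
    (hst : s ≤ t) (htT : t < T) (hc : ∀ c ∈ changePoints P X T, c ≤ s ∨ t < c) (i : Fin K) :
    meanReward P X s i = meanReward P X t i := by
  have key : ∀ r, s ≤ r → r ≤ t → meanReward P X s i = meanReward P X r i := by
    intro r hr
    induction r, hr using Nat.le_induction with
    | base => exact fun _ => rfl
    | succ r hr ih =>
      intro hrt
      rw [ih (by omega)]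
      refine hX.meanReward_eq_of_map_eq ?_
      by_contra hne
      have hmem : r + 1 ∈ changePoints P X T := by
        simp only [changePoints, Finset.mem_filter, Finset.mem_Ico]
        exact ⟨⟨by omega, by omega⟩, i, by simpa using hne⟩
      have := hc _ hmem
      omega
  exact key t hst le_rfl

theorem IsRewardProcess.meanReward_mem_Icc [IsProbabilityMeasure P]
    (hX : IsRewardProcess P B X) (t : ℕ) (i : Fin K) :
    meanReward P X t i ∈ Set.Icc 0 B := by
  have hi : Integrable (X t i) P :=
    Integrable.of_mem_Icc 0 B (hX.measurable t i).aemeasurable (hX.mem_Icc t i)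
  constructor
  · exact integral_nonneg_of_ae ((hX.mem_Icc t i).mono fun ω h => h.1)
  · have h := integral_mono_ae hi (integrable_const B) ((hX.mem_Icc t i).mono fun ω h => h.2)
    simpa [meanReward] using h

end Means

/-! ### From the pointwise bound to expected regret -/

section Regret

variable {K : ℕ} {Ω : Type u} [MeasurableSpace Ω] {P : Measure Ω}
  {B : ℝ} {X : ℕ → Fin K → Ω → ℝ}

theorem regret_nonneg (t : ℕ) (a : Fin K) :
    0 ≤ (⨆ i, meanReward P X t i) - meanReward P X t a :=
  sub_nonneg.2 (le_ciSup (Set.finite_range _).bddAbove a)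

variable [IsProbabilityMeasure P]

theorem IsRewardProcess.regret_le (hX : IsRewardProcess P B X) (t : ℕ) (a : Fin K) :
    (⨆ i, meanReward P X t i) - meanReward P X t a ≤ B := by
  have : Nonempty (Fin K) := ⟨a⟩
  linarith [ciSup_le fun i => (hX.meanReward_mem_Icc t i).2, (hX.meanReward_mem_Icc t a).1]

theorem IsRewardProcess.expectedRegret_le_trivial (hX : IsRewardProcess P B X) (π : Policy K)
    (T : ℕ) : expectedRegret P X π T ≤ B * T := by
  have h := integral_mono_of_nonneg (μ := P)
    (f := fun ω => ∑ t ∈ Finset.range T, ((⨆ i, meanReward P X t i) -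
      meanReward P X t (π.arm (fun s j => X s j ω) t))) (g := fun _ => B * T)
    (Filter.Eventually.of_forall fun ω => Finset.sum_nonneg fun t _ => regret_nonneg t _)
    (integrable_const _) (Filter.Eventually.of_forall fun ω => by
      refine (Finset.sum_le_sum fun t _ => hX.regret_le t _).trans (le_of_eq ?_)
      simp [mul_comm])
  simpa [expectedRegret] using h

/-- In an initial round, or within `τ` rounds of a change, an indicator equal to 1 covers the
trivial bound `B`; every other round has a full stationary window. -/
theorem IsRewardProcess.regret_le_pointwise (hX : IsRewardProcess P B X) {π : Policy K} {ξ : ℝ}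
    (hξ : 1 / 2 < ξ) (hB : 0 < B) {τ t T : ℕ} (hπ : π.IsSWUCB B ξ τ) (hτ : 1 ≤ τ) (htT : t < T)
    (x : ℕ → Fin K → ℝ) :
    (⨆ i, meanReward P X t i) - meanReward P X t (π.arm x t) ≤
      B * ((if t < K then 1 else 0) + (if t < τ then 1 else 0) +
        (∑ c ∈ changePoints P X T, if t ∈ Finset.Ico c (c + τ) then 1 else 0) +
        blockCost (2 * √(ξ * Real.log τ))
          (playRounds (π.arm x) (t / τ * τ) t (π.arm x t)).card +
        (∑ j, peelWeight π (meanReward P X) ξ B τ t j x) / τ) := by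
  have htriv := hX.regret_le t (π.arm x t)
  have hc : 0 ≤ 2 * √(ξ * Real.log τ) := by positivity
  have h1 : (0 : ℝ) ≤ if t < K then 1 else 0 := by split_ifs <;> norm_num
  have h2 : (0 : ℝ) ≤ if t < τ then 1 else 0 := by split_ifs <;> norm_num
  have h3' : ∀ c ∈ changePoints P X T, (0 : ℝ) ≤ if t ∈ Finset.Ico c (c + τ) then 1 else 0 :=
    fun c _ => by split_ifs <;> norm_num
  have h3 := Finset.sum_nonneg h3'
  have h4 := blockCost_nonneg hc (playRounds (π.arm x) (t / τ * τ) t (π.arm x t)).card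
  have h5 : 0 ≤ (∑ j, peelWeight π (meanReward P X) ξ B τ t j x) / τ :=
    div_nonneg (Finset.sum_nonneg fun j _ => peelWeight_nonneg _ _ _ _ _ _ _ _)
      (Nat.cast_nonneg _)
  by_cases hbad : t < K ∨ t < τ ∨ ∃ c ∈ changePoints P X T, t ∈ Finset.Ico c (c + τ)
  · refine htriv.trans (le_mul_of_one_le_right hB.le ?_)
    rcases hbad with h | h | ⟨c, hcm, h⟩
    · rw [if_pos h] at *
      linarith
    · rw [if_pos h] at h2 ⊢
      linarith
    · have h6 := Finset.single_le_sum h3' hcm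
      simp only [if_pos h] at h6
      linarith
  · push Not at hbad
    obtain ⟨hK, hτt, hch⟩ := hbad
    have : Nonempty (Fin K) := ⟨π.arm x t⟩
    rw [sub_le_iff_le_add]
    refine ciSup_le fun i => ?_
    rw [← sub_le_iff_le_add]
    refine (regret_le_of_stationary hξ hB hπ hτ hτt hK x i (fun i s hs hst => ?_)
      (hX.meanReward_mem_Icc t)).trans (mul_le_mul_of_nonneg_left (by linarith) hB.le)
    refine hX.meanReward_eq_of_no_change hst.le htT (fun c hcm => ?_) i
    have := hch c hcm
    rw [Finset.mem_Ico] at this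
    omega

theorem sum_indicator_lt_le (T n : ℕ) :
    ∑ t ∈ Finset.range T, (if t < n then (1 : ℝ) else 0) ≤ n := by
  rw [Finset.sum_boole]
  have h : {t ∈ Finset.range T | t < n} ⊆ Finset.range n := fun t ht => by
    simpa using (Finset.mem_filter.1 ht).2
  simpa using Nat.cast_le (α := ℝ).2 (Finset.card_le_card h)

theorem sum_indicator_Ico_le (T c τ : ℕ) :
    ∑ t ∈ Finset.range T, (if t ∈ Finset.Ico c (c + τ) then (1 : ℝ) else 0) ≤ τ := by
  rw [Finset.sum_boole]
  have h : {t ∈ Finset.range T | t ∈ Finset.Ico c (c + τ)} ⊆ Finset.Ico c (c + τ) :=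
    fun t ht => (Finset.mem_filter.1 ht).2
  simpa using Nat.cast_le (α := ℝ).2 (Finset.card_le_card h)

theorem IsRewardProcess.integral_peelWeight_le (hX : IsRewardProcess P B X) (π : Policy K)
    (ξ : ℝ) (τ t : ℕ) (i : Fin K) :
    Integrable (fun ω => peelWeight π (meanReward P X) ξ B τ t i fun s j => X s j ω) P ∧
      ∫ ω, peelWeight π (meanReward P X) ξ B τ t i (fun s j => X s j ω) ∂P ≤
        2 * peelCount ξ (Real.log τ) := by
  have h (l : ℝ) := hX.integral_expWeight_le π i l (Nat.sub_le t τ)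
  unfold peelWeight
  refine ⟨integrable_finsetSum _ fun k _ => (h _).1.add (h _).1, ?_⟩
  rw [integral_finsetSum _ fun k _ => by exact (h _).1.add (h _).1]
  refine (Finset.sum_le_card_nsmul _ _ 2 fun k _ => ?_).trans
    (le_of_eq (by simp [mul_comm]))
  rw [integral_add (h _).1 (h _).1]
  linarith [(h (peelRate ξ B (Real.log τ) k)).2, (h (-peelRate ξ B (Real.log τ) k)).2]

theorem IsRewardProcess.expectedRegret_le_window (hX : IsRewardProcess P B X) {π : Policy K}
    {ξ : ℝ} (hξ : 1 / 2 < ξ) (hB : 0 < B) {τ T Γ : ℕ} (hπ : π.IsSWUCB B ξ τ) (hτ : 1 ≤ τ)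
    (hΓ : (changePoints P X T).card ≤ Γ) :
    expectedRegret P X π T ≤
      B * ((K + τ + Γ * τ + ((T : ℝ) / τ + 1) *
        (K + 2 * (2 * √(ξ * Real.log τ)) * (√(K : ℝ) * √(τ : ℝ)))) +
        T * (K * (2 * peelCount ξ (Real.log τ))) / τ) := by
  have hc : 0 ≤ 2 * √(ξ * Real.log τ) := by positivity
  set V : Ω → ℝ := fun ω => ∑ t ∈ Finset.range T, ∑ j,
    peelWeight π (meanReward P X) ξ B τ t j fun s j => X s j ω with hV
  set c₀ : ℝ := K + τ + Γ * τ + ((T : ℝ) / τ + 1) *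
    (K + 2 * (2 * √(ξ * Real.log τ)) * (√(K : ℝ) * √(τ : ℝ))) with hc₀
  have hint (t : ℕ) (j : Fin K) := hX.integral_peelWeight_le π ξ τ t j
  have hVi : Integrable V P :=
    integrable_finsetSum _ fun t _ => integrable_finsetSum _ fun j _ => (hint t j).1
  have hVle : ∫ ω, V ω ∂P ≤ T * (K * (2 * peelCount ξ (Real.log τ))) := by
    rw [hV, integral_finsetSum _ fun t _ => integrable_finsetSum _ fun j _ => (hint t j).1]
    refine (Finset.sum_le_card_nsmul _ _ ((K : ℝ) * (2 * peelCount ξ (Real.log τ))) fun t _ => ?_).trans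
      (le_of_eq (by simp [nsmul_eq_mul]))
    rw [integral_finsetSum _ fun j _ => (hint t j).1]
    exact (Finset.sum_le_card_nsmul _ _ _ fun j _ => (hint t j).2).trans (le_of_eq (by simp))
  have hpt : ∀ ω, ∑ t ∈ Finset.range T, ((⨆ i, meanReward P X t i) -
      meanReward P X t (π.arm (fun s j => X s j ω) t)) ≤ B * (c₀ + V ω / τ) := by
    intro ω
    refine (Finset.sum_le_sum fun t ht => hX.regret_le_pointwise hξ hB hπ hτ
      (Finset.mem_range.1 ht) fun s j => X s j ω).trans ?_
    rw [← Finset.mul_sum]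
    refine mul_le_mul_of_nonneg_left ?_ hB.le
    simp only [Finset.sum_add_distrib]
    rw [← Finset.sum_div, hc₀]
    have h1 : ∑ t ∈ Finset.range T, ∑ c ∈ changePoints P X T,
        (if t ∈ Finset.Ico c (c + τ) then (1 : ℝ) else 0) ≤ Γ * τ := by
      rw [Finset.sum_comm]
      refine (Finset.sum_le_card_nsmul _ _ _ fun c _ => sum_indicator_Ico_le T c τ).trans ?_
      rw [nsmul_eq_mul]
      gcongr
    have h2 := sum_blockCost_horizon_le (π.arm fun s j => X s j ω) hc (T := T) hτ
    linarith [sum_indicator_lt_le T K, sum_indicator_lt_le T τ]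
  have hg : Integrable (fun ω => B * (c₀ + V ω / τ)) P :=
    ((integrable_const c₀).add (hVi.div_const _)).const_mul B
  -- Nonnegativity of the regret means that only the dominating function has to be integrable.
  have h := integral_mono_of_nonneg (μ := P)
    (Filter.Eventually.of_forall fun ω => Finset.sum_nonneg fun t _ =>
      regret_nonneg (P := P) (X := X) t (π.arm (fun s j => X s j ω) t)) hg
    (Filter.Eventually.of_forall hpt)
  refine h.trans ?_
  rw [integral_const_mul, integral_add (integrable_const c₀) (hVi.div_const _), integral_div]
  simp only [integral_const, probReal_univ, one_smul]
  gcongr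

/-- The constant of the regret bound. -/
noncomputable def regretConst (ξ : ℝ) : ℝ := 8 * (1 + ξ) + 5 + 1 / Real.log (peelBase ξ)

theorem one_le_regretConst {ξ : ℝ} (hξ : 1 / 2 < ξ) : 1 ≤ regretConst ξ := by
  have := Real.log_pos (one_lt_peelBase hξ)
  have : 0 < 1 / Real.log (peelBase ξ) := by positivity
  unfold regretConst
  linarith

theorem IsRewardProcess.expectedRegret_le (hX : IsRewardProcess P B X) {π : Policy K}
    {ξ : ℝ} (hξ : 1 / 2 < ξ) (hB : 0 < B) {τ T Γ : ℕ} (hπ : π.IsSWUCB B ξ τ) (hK : 1 ≤ K)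
    (hτ : 1 ≤ τ) (hΓ1 : 1 ≤ Γ) (hΓ : (changePoints P X T).card ≤ Γ) :
    expectedRegret P X π T ≤
      B * (regretConst ξ * (1 + Real.log τ) *
        (√(K : ℝ) * ((T : ℝ) / √(τ : ℝ)) + √(K : ℝ) * τ * Γ + K * ((T : ℝ) / τ))) := by
  have hA := one_le_regretConst hξ
  have hτ1 : (1 : ℝ) ≤ τ := by exact_mod_cast hτ
  have hΓ1' : (1 : ℝ) ≤ Γ := by exact_mod_cast hΓ1
  have hK1 : (1 : ℝ) ≤ √(K : ℝ) := Real.one_le_sqrt.2 (by exact_mod_cast hK)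
  have hT0 : (0 : ℝ) ≤ T := Nat.cast_nonneg T
  have hL : 0 ≤ Real.log τ := Real.log_nonneg hτ1
  set L := Real.log τ with hLdef
  have hτ0 : (0 : ℝ) < τ := by linarith
  have hs := Real.sqrt_pos.2 hτ0
  have hss := Real.mul_self_sqrt hτ0.le
  set U := √(K : ℝ) * ((T : ℝ) / √(τ : ℝ)) with hU
  set V := √(K : ℝ) * τ * Γ with hV
  set W := (K : ℝ) * ((T : ℝ) / τ) with hW
  have hU0 : 0 ≤ U := by positivity
  have hV0 : 0 ≤ V := by positivity
  have hW0 : 0 ≤ W := by positivity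
  have hτΓ : τ * Γ ≤ V := by
    rw [hV, mul_assoc]
    exact le_mul_of_one_le_left (by positivity) hK1
  have hτV : τ ≤ V := (le_mul_of_one_le_right hτ0.le hΓ1').trans hτΓ
  -- If `T < τ`, the trivial bound `B T` is below the second term. If `T ≥ τ`, then `T / τ ≥ 1`
  -- absorbs the extra block and the additive `K`.
  rcases lt_or_ge T τ with hTτ | hTτ
  · refine (hX.expectedRegret_le_trivial π T).trans (mul_le_mul_of_nonneg_left ?_ hB.le)
    have h1 : (T : ℝ) ≤ τ := by exact_mod_cast hTτ.le
    have h2 : 1 ≤ regretConst ξ * (1 + L) := one_le_mul_of_one_le_of_one_le hA (by linarith)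
    refine le_trans ?_ (le_mul_of_one_le_left (by positivity) h2)
    linarith
  refine (hX.expectedRegret_le_window hξ hB hπ hτ hΓ).trans (mul_le_mul_of_nonneg_left ?_ hB.le)
  have hTτ1 : 1 ≤ (T : ℝ) / τ := by
    rw [one_le_div hτ0]
    exact_mod_cast hTτ
  have hKW : (K : ℝ) ≤ W := le_mul_of_one_le_right (Nat.cast_nonneg K) hTτ1
  have hsq : √(ξ * L) ≤ (1 + ξ) * (1 + L) := by
    refine (Real.sqrt_le_left (by nlinarith)).2 ?_
    have : 0 ≤ ξ * L := mul_nonneg (by linarith) hL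
    nlinarith
  have hblock : ((T : ℝ) / τ + 1) * (K + 2 * (2 * √(ξ * L)) * (√(K : ℝ) * √(τ : ℝ))) ≤
      2 * W + 8 * √(ξ * L) * U := by
    calc _ ≤ (2 * ((T : ℝ) / τ)) * (K + 2 * (2 * √(ξ * L)) * (√(K : ℝ) * √(τ : ℝ))) := by
          gcongr
          linarith
      _ = _ := by
          rw [hW, hU]
          have : (T : ℝ) / τ * √(τ : ℝ) = T / √(τ : ℝ) := by
            rw [div_mul_eq_mul_div, div_eq_div_iff hτ0.ne' hs.ne', mul_assoc, hss]
          linear_combination (8 * √(ξ * L) * √(K : ℝ)) * this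
  have hlog := Real.log_pos (one_lt_peelBase hξ)
  have hpeel : (T : ℝ) * (K * (2 * peelCount ξ L)) / τ ≤
      (L * (1 / Real.log (peelBase ξ)) + 2) * W := by
    have h1 : (peelCount ξ L : ℝ) ≤ L / (2 * Real.log (peelBase ξ)) + 1 := by
      rw [peelCount]
      push_cast
      gcongr
      exact Nat.floor_le (by positivity)
    have h2 : (T : ℝ) * (K * (2 * peelCount ξ L)) / τ = 2 * peelCount ξ L * W := by
      rw [hW]
      ring
    rw [h2]
    refine mul_le_mul_of_nonneg_right ?_ hW0
    have h3 : 2 * (L / (2 * Real.log (peelBase ξ)) + 1) = L * (1 / Real.log (peelBase ξ)) + 2 := by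
      field_simp
    linarith
  set d := 1 / Real.log (peelBase ξ) with hd
  have hd0 : 0 < d := by positivity
  have hUc : 8 * √(ξ * L) * U ≤ regretConst ξ * (1 + L) * U := by
    refine mul_le_mul_of_nonneg_right ?_ hU0
    unfold regretConst
    nlinarith
  have hVc : 2 * V ≤ regretConst ξ * (1 + L) * V := by
    refine mul_le_mul_of_nonneg_right ?_ hV0
    unfold regretConst
    nlinarith
  -- The 5 collects 1 from the initial `K` rounds, 2 from the first plays in blocks and 2 from the
  -- rounding in `peelCount`.
  have hWc : (L * d + 5) * W ≤ regretConst ξ * (1 + L) * W := by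
    refine mul_le_mul_of_nonneg_right ?_ hW0
    unfold regretConst
    nlinarith
  rw [mul_comm] at hτΓ
  linarith

end Regret

/-! ### The tuned window length -/

section Tuning

/-- The three terms of the regret bound for the tuned window length, in terms of `k = K ^ (1 / 6)`,
`g = Γ ^ (1 / 3)` and `y = T ^ (1 / 3)`. -/
theorem tuned_terms_le {k g y τ : ℝ} (hk : 1 ≤ k) (hg : 1 ≤ g) (hy : 1 ≤ y) (hτ : 1 ≤ τ)
    (hτy : |τ - y ^ 2 / (k ^ 2 * g ^ 2)| < 1) (h1 : k * g ≤ y) (h2 : k ^ 4 * g ≤ y) :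
    k ^ 3 * (y ^ 3 / √τ) + k ^ 3 * τ * g ^ 3 + k ^ 6 * (y ^ 3 / τ) ≤ 6 * (k ^ 4 * g * y ^ 2) := by
  have hk0 : 0 < k := by linarith
  have hg0 : 0 < g := by linarith
  have hy0 : 0 < y := by linarith
  set z := y / (k * g) with hz
  have hz1 : 1 ≤ z := (one_le_div (by positivity)).2 h1
  have hyz : y = z * (k * g) := by rw [hz]; field_simp
  have hz2 : y ^ 2 / (k ^ 2 * g ^ 2) = z ^ 2 := by rw [hz, div_pow, mul_pow]
  rw [hz2] at hτy
  obtain ⟨ha, hb⟩ := abs_lt.1 hτy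
  -- The ideal window is `z ^ 2`; since `z` and `τ` are at least 1, rounding changes it by a factor
  -- of at most 2 either way.
  have hzτ : z ^ 2 ≤ 2 * τ := by linarith
  have hτz : τ ≤ 2 * z ^ 2 := by nlinarith
  have hz0 : 0 < z := by linarith
  have hs : z / 2 ≤ √τ := Real.le_sqrt_of_sq_le (by nlinarith)
  have e1 : k ^ 3 * (y ^ 3 / √τ) ≤ 2 * (k ^ 4 * g * y ^ 2) := by
    calc _ ≤ k ^ 3 * (y ^ 3 / (z / 2)) := by gcongr
      _ = _ := by rw [hyz]; field_simp
  have e2 : k ^ 3 * τ * g ^ 3 ≤ 2 * (k ^ 4 * g * y ^ 2) := by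
    calc _ ≤ k ^ 3 * (2 * z ^ 2) * g ^ 3 := by gcongr
      _ = 2 * (k * g * y ^ 2) := by rw [hyz]; ring
      _ ≤ _ := by
        gcongr
        exact le_self_pow₀ hk (by norm_num)
  -- Only this term needs `k ^ 4 * g ≤ y`, that is, `K² Γ ≤ T`.
  have e3 : k ^ 6 * (y ^ 3 / τ) ≤ 2 * (k ^ 4 * g * y ^ 2) := by
    calc _ ≤ k ^ 6 * (y ^ 3 / (z ^ 2 / 2)) := by
          gcongr
          linarith
      _ = 2 * (k ^ 4 * g * (k ^ 4 * g) * y) := by rw [hyz]; field_simp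
      _ ≤ 2 * (k ^ 4 * g * y * y) := by gcongr
      _ = _ := by ring
  linarith

/-- Since `k * g ≤ k ^ 4 * g`, failure of either condition forces `y ≤ k ^ 4 * g`; then `T = y ^ 3`
is already below the target. -/
theorem trivial_le_tuned {k g y : ℝ} (hk : 1 ≤ k) (hg : 1 ≤ g) (hy : 1 ≤ y)
    (h : ¬(k * g ≤ y ∧ k ^ 4 * g ≤ y)) : y ^ 3 ≤ k ^ 4 * g * y ^ 2 := by
  have h1 : y ≤ k ^ 4 * g := by
    by_contra! h'
    refine h ⟨le_trans ?_ h'.le, h'.le⟩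
    gcongr
    exact le_self_pow₀ hk (by norm_num)
  calc y ^ 3 = y * y ^ 2 := by ring
    _ ≤ _ := by gcongr

theorem rpow_div_eq_pow {a : ℝ} (ha : 0 ≤ a) (n m : ℕ) :
    a ^ ((m : ℝ) / (n : ℝ)) = (a ^ (1 / (n : ℝ))) ^ m := by
  rw [← Real.rpow_natCast, ← Real.rpow_mul ha]
  congr 1
  ring

theorem IsRewardProcess.expectedRegret_le_tuned {K : ℕ} {Ω : Type u} [MeasurableSpace Ω]
    {P : Measure Ω} [IsProbabilityMeasure P] {B : ℝ} {X : ℕ → Fin K → Ω → ℝ}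
    (hX : IsRewardProcess P B X) {π : Policy K} {ξ : ℝ} (hξ : 1 / 2 < ξ) (hB : 0 < B)
    {τ T Γ : ℕ} (hπ : π.IsSWUCB B ξ τ) (hK : 1 ≤ K) (hT : 1 ≤ T) (hτ : 1 ≤ τ) (hΓ1 : 1 ≤ Γ)
    (hΓ : (changePoints P X T).card ≤ Γ)
    (hτT : |(τ : ℝ) - (T : ℝ) ^ (2 / 3 : ℝ) / ((K : ℝ) ^ (1 / 3 : ℝ) * (Γ : ℝ) ^ (2 / 3 : ℝ))|
      < 1) :
    expectedRegret P X π T ≤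
      B * (12 * regretConst ξ * (1 + Real.log T) ^ 1 *
        ((K : ℝ) ^ (2 / 3 : ℝ) * (Γ : ℝ) ^ (1 / 3 : ℝ) * (T : ℝ) ^ (2 / 3 : ℝ))) := by
  have hK1 : (1 : ℝ) ≤ K := by exact_mod_cast hK
  have hT1 : (1 : ℝ) ≤ T := by exact_mod_cast hT
  have hτ1 : (1 : ℝ) ≤ τ := by exact_mod_cast hτ
  have hΓ1' : (1 : ℝ) ≤ Γ := by exact_mod_cast hΓ1
  have hK0 : (0 : ℝ) ≤ K := by linarith
  have hT0 : (0 : ℝ) ≤ T := by linarith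
  have hΓ0 : (0 : ℝ) ≤ Γ := by linarith
  have hA := one_le_regretConst hξ
  have hLT : 0 ≤ Real.log T := Real.log_nonneg hT1
  have hlogτ : 1 + Real.log τ ≤ 2 * (1 + Real.log T) := by
    have h1 : (T : ℝ) ^ (2 / 3 : ℝ) / ((K : ℝ) ^ (1 / 3 : ℝ) * (Γ : ℝ) ^ (2 / 3 : ℝ)) ≤ T := by
      have h2 : 1 ≤ (K : ℝ) ^ (1 / 3 : ℝ) * (Γ : ℝ) ^ (2 / 3 : ℝ) :=
        one_le_mul_of_one_le_of_one_le (Real.one_le_rpow hK1 (by norm_num))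
          (Real.one_le_rpow hΓ1' (by norm_num))
      refine (div_le_self (by positivity) h2).trans ?_
      simpa using Real.rpow_le_rpow_of_exponent_le hT1 (by norm_num : (2 / 3 : ℝ) ≤ 1)
    -- The unrounded window is at most `T`, and rounding adds less than `1 ≤ T`.
    have h3 : (τ : ℝ) ≤ 2 * T := by linarith [(abs_lt.1 hτT).2]
    have h4 := Real.log_le_log (by linarith) h3
    rw [Real.log_mul (by norm_num) (by linarith)] at h4
    linarith [Real.log_two_lt_d9]
  have hwin := hX.expectedRegret_le hξ hB hπ hK hτ hΓ1 hΓ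
  have htriv := hX.expectedRegret_le_trivial π T
  have hk : 1 ≤ (K : ℝ) ^ (1 / 6 : ℝ) := Real.one_le_rpow hK1 (by norm_num)
  have hg : 1 ≤ (Γ : ℝ) ^ (1 / 3 : ℝ) := Real.one_le_rpow hΓ1' (by norm_num)
  have hy : 1 ≤ (T : ℝ) ^ (1 / 3 : ℝ) := Real.one_le_rpow hT1 (by norm_num)
  have eK6 := rpow_div_eq_pow hK0 6 6
  have eK4 := rpow_div_eq_pow hK0 6 4
  have eK3 := rpow_div_eq_pow hK0 6 3
  have eK2 := rpow_div_eq_pow hK0 6 2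
  have eΓ3 := rpow_div_eq_pow hΓ0 3 3
  have eΓ2 := rpow_div_eq_pow hΓ0 3 2
  have eT3 := rpow_div_eq_pow hT0 3 3
  have eT2 := rpow_div_eq_pow hT0 3 2
  norm_num only [Nat.cast_ofNat, Real.rpow_one] at eK6 eK4 eK3 eK2 eΓ3 eΓ2 eT3 eT2
  rw [← Real.sqrt_eq_rpow] at eK3
  norm_num only at hk hg hy hτT ⊢
  rw [eK2, eΓ2, eT2] at hτT
  rw [eK4, eT2]
  rw [eK3] at hwin
  generalize (K : ℝ) ^ (1 / 6 : ℝ) = k at *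
  generalize (Γ : ℝ) ^ (1 / 3 : ℝ) = g at *
  generalize (T : ℝ) ^ (1 / 3 : ℝ) = y at *
  rw [eK6, eΓ3, eT3] at hwin
  have hR : 0 ≤ k ^ 4 * g * y ^ 2 := by positivity
  by_cases h : k * g ≤ y ∧ k ^ 4 * g ≤ y
  · refine hwin.trans (mul_le_mul_of_nonneg_left ?_ hB.le)
    -- The constant 12 is 2, from replacing `log τ` by `log T`, times 6, from the three tuned terms.
    calc _ ≤ regretConst ξ * (2 * (1 + Real.log T)) * (6 * (k ^ 4 * g * y ^ 2)) := by
          have := tuned_terms_le hk hg hy hτ1 hτT h.1 h.2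
          gcongr
      _ = _ := by ring
  · refine htriv.trans (mul_le_mul_of_nonneg_left ?_ hB.le)
    rw [eT3] at hLT ⊢
    refine (trivial_le_tuned hk hg hy h).trans (le_mul_of_one_le_left hR ?_)
    rw [pow_one]
    exact one_le_mul_of_one_le_of_one_le (by linarith) (by linarith)

end Tuning

theorem polyGrowth_const_mul_one_add {A : ℝ} (hA : 0 ≤ A) : PolyGrowth fun x => A * (1 + x) :=
  ⟨A, 1, fun x hx => by rw [abs_of_nonneg (by positivity), pow_one]⟩

end SWBandit

theorem mainTheorem7 (ξ : ℝ) (hξ : 1 / 2 < ξ) :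
    (∃ C₁ C₂ C₃ : ℝ → ℝ,
      SWBandit.PolyGrowth C₁ ∧ SWBandit.PolyGrowth C₂ ∧ SWBandit.PolyGrowth C₃ ∧
      ∀ (K T τ Γ : ℕ) (B : ℝ), 1 ≤ K → 1 ≤ τ → 1 ≤ Γ → 0 < B →
      ∀ (Ω : Type u) [MeasurableSpace Ω] (P : Measure Ω) [IsProbabilityMeasure P]
        (X : ℕ → Fin K → Ω → ℝ) (π : SWBandit.Policy K),
        SWBandit.IsRewardProcess P B X →
        (SWBandit.changePoints P X T).card ≤ Γ →
        π.IsSWUCB B ξ τ →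
        SWBandit.expectedRegret P X π T ≤
          B * (C₁ (Real.log τ) * √(K : ℝ) * ((T : ℝ) / √(τ : ℝ))
            + C₂ (Real.log τ) * √(K : ℝ) * (τ : ℝ) * (Γ : ℝ)
            + C₃ (Real.log τ) * (K : ℝ) * ((T : ℝ) / (τ : ℝ)))) ∧
    (∃ (C : ℝ) (p : ℕ),
      ∀ (K T τ Γ : ℕ) (B : ℝ), 1 ≤ K → 1 ≤ T → 1 ≤ τ → 1 ≤ Γ → 0 < B →
      |(τ : ℝ) - (T : ℝ) ^ (2 / 3 : ℝ) / ((K : ℝ) ^ (1 / 3 : ℝ) * (Γ : ℝ) ^ (2 / 3 : ℝ))| < 1 →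
      ∀ (Ω : Type u) [MeasurableSpace Ω] (P : Measure Ω) [IsProbabilityMeasure P]
        (X : ℕ → Fin K → Ω → ℝ) (π : SWBandit.Policy K),
        SWBandit.IsRewardProcess P B X →
        (SWBandit.changePoints P X T).card ≤ Γ →
        π.IsSWUCB B ξ τ →
        SWBandit.expectedRegret P X π T ≤
          B * (C * (1 + Real.log T) ^ p *
            ((K : ℝ) ^ (2 / 3 : ℝ) * (Γ : ℝ) ^ (1 / 3 : ℝ) * (T : ℝ) ^ (2 / 3 : ℝ)))) := by
  have hA : 0 ≤ SWBandit.regretConst ξ := zero_le_one.trans (SWBandit.one_le_regretConst hξ)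
  have hpoly := SWBandit.polyGrowth_const_mul_one_add hA
  refine ⟨⟨_, _, _, hpoly, hpoly, hpoly, ?_⟩, 12 * SWBandit.regretConst ξ, 1, ?_⟩
  · intro K T τ Γ B hK hτ hΓ1 hB Ω _ P _ X π hX hΓ hπ
    refine (hX.expectedRegret_le hξ hB hπ hK hτ hΓ1 hΓ).trans (le_of_eq ?_)
    ring
  · intro K T τ Γ B hK hT hτ hΓ1 hB hτT Ω _ P _ X π hX hΓ hπ
    exact hX.expectedRegret_le_tuned hξ hB hπ hK hT hτ hΓ1 hΓ hτT
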